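/- Let $\Bbbk$ be a field, let $n\ge 0$, and let $\Bbbk[\mathbf X]=\Bbbk[X_1,\dots,X_n]$. A binomial is a polynomial with at most two terms, and a binomial ideal is an ideal generated by binomials. A binomial ideal is unital if it is generated by binomials $\mathbf X^{\mathbf u}-\lambda\mathbf X^{\mathbf v}$ with $\lambda\in\{0,1\}$. A binomial ideal $J$ induces the congruence $\sim$ on $\mathbb N^n$ if $\mathbf u\sim\mathbf v \iff \mathbf X^{\mathbf u}-\lambda\mathbf X^{\mathbf v}\in J$ for some $\lambda\in\Bbbk^*$. For a congruence $\sim$ on $\mathbb N^n$, let $I_\sim$ be the unital binomial ideal that is maximal among all proper binomial ideals inducing $\sim$. Explicitly, $$I_\sim=\langle \mathbf X^{\mathbf u}-\mathbf X^{\mathbf v}\mid \mathbf u\sim\mathbf v\rangle+\langle \mathbf X^{\mathbf e}\mid [\mathbf e]=\infty\rangle,$$ where $\infty$ denotes the nil element of $\mathbb N^n/\!\sim$ (the non-identity element with $\mathbf a+\infty=\infty$ for all $\mathbf a$), if there is one. For $\delta\subseteq\{1,\dots,n\}$, a proper ideal $I$ is $\delta$-cellular if $I:X_i=I$ for all $i\in\delta$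 and, for every $i\notin\delta$, some power of $X_i$ lies in $I$. It is cellular if it is $\delta$-cellular for some $\delta$. Let $\mathbb Z^\delta=\{\mathbf w\in\mathbb Z^n\mid w_i=0 \text{ for } i\notin\delta\}$ and $\mathfrak p_{\delta^c}=\langle X_j\mid j\notin\delta\rangle$. For a subgroup $\mathcal L\subseteq\mathbb Z^\delta$ and a homomorphism $\rho:\mathcal L\to\Bbbk^*$, put $$I_{\mathcal L}(\rho)=\langle\mathbf X^{\mathbf u}-\rho(\mathbf u-\mathbf v)\mathbf X^{\mathbf v}\mid\mathbf u-\mathbf v\in\mathcal L\rangle .$$ If $I$ is a $\delta$-cellular binomial ideal, then $I_{\mathcal L}(\rho)+\mathfrak p_{\delta^c}$ is a mesoprime associated to $I$ if there is a monomial $\mathbf X^{\mathbf u}\in\Bbbk[\{X_i\}_{i\notin\delta}]$ with $$\big((I:\mathbf X^{\mathbf u})\cap\Bbbk[\{X_i\}_{i\in\delta}]\big)\,\Bbbk[\mathbf X]=I_{\mathcal L}(\rho).$$ A binomial ideal is mesoprimary if it is cellular and has exactly one associated mesoprime. The congruence $\sim$ is primary if $I_\sim$ is cellular, and mesoprimary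 if $I_\sim$ is mesoprimary. An element $\mathbf a$ of $\mathbb N^n/\!\sim$ is cancellable if $\mathbf b+\mathbf a=\mathbf c+\mathbf a$ implies $\mathbf b=\mathbf c$ for all $\mathbf b,\mathbf c\in\mathbb N^n/\!\sim$. It is partly cancellable if, for all cancellable $\mathbf b,\mathbf c\in\mathbb N^n/\!\sim$, $\mathbf a+\mathbf b=\mathbf a+\mathbf c\neq\infty$ implies $\mathbf b=\mathbf c$ (the condition $\neq\infty$ being void if there is no nil element). **Proposition.** A congruence $\sim$ on $\mathbb N^n$ is mesoprimary if and only if it is primary and every element of $\mathbb N^n/\!\sim$ is partly cancellable. -/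

import Mathlib

namespace BinomialCongruence

open MvPolynomial

/-! ### Monoid elements -/

section Monoid

variable {S : Type*} [AddCommMonoid S]

/-- A nil element `∞` of a monoid: a non-identity element with `a + ∞ = ∞` for all `a`. -/
def IsNil (x : S) : Prop := x ≠ 0 ∧ ∀ a : S, a + x = x

/-- An element that can be cancelled in sums. -/
def IsCancellable (a : S) : Prop := ∀ b c : S, b + a = c + a → b = c

/-- `a` is partly cancellable: `a + b = a + c ≠ ∞` implies `b = c` for cancellable `b`, `c`. -/
def IsPartlyCancellable (a : S) : Prop :=
  ∀ b c : S, IsCancellable b → IsCancellable c → a + b = a + c → ¬ IsNil (a + b) → b = c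

end Monoid

/-! ### Binomial ideals and congruences on `ℕⁿ` -/

section Ideals

variable {k : Type*} [Field k] {n : ℕ}

/-- A polynomial with at most two terms. -/
def IsBinomial (f : MvPolynomial (Fin n) k) : Prop :=
  ∃ (u v : Fin n →₀ ℕ) (a b : k), f = monomial u a + monomial v b

/-- An ideal generated by binomials. -/
def IsBinomialIdeal (I : Ideal (MvPolynomial (Fin n) k)) : Prop :=
  ∃ B : Set (MvPolynomial (Fin n) k), (∀ f ∈ B, IsBinomial f) ∧ I = Ideal.span B

/-- An ideal generated by binomials `X^u - t X^v` with `t ∈ {0, 1}`. -/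
def IsUnitalIdeal (I : Ideal (MvPolynomial (Fin n) k)) : Prop :=
  ∃ B : Set (MvPolynomial (Fin n) k),
    (∀ f ∈ B, ∃ (u v : Fin n →₀ ℕ) (t : k), (t = 0 ∨ t = 1) ∧
      f = monomial u 1 - monomial v t) ∧ I = Ideal.span B

/-- The ideal `J` induces the congruence `c`: `u ∼ v` if and only if `X^u - t X^v ∈ J` for some
nonzero scalar `t`. -/
def Induces (J : Ideal (MvPolynomial (Fin n) k)) (c : AddCon (Fin n →₀ ℕ)) : Prop :=
  ∀ u v : Fin n →₀ ℕ, c u v ↔ ∃ t : k, t ≠ 0 ∧ monomial u 1 - monomial v t ∈ J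

/-- `I` is a unital binomial ideal that is maximal among all proper binomial ideals
inducing `c`. -/
def IsAssociatedIdeal (c : AddCon (Fin n →₀ ℕ)) (I : Ideal (MvPolynomial (Fin n) k)) : Prop :=
  IsUnitalIdeal I ∧
    Maximal (fun J : Ideal (MvPolynomial (Fin n) k) =>
      J ≠ ⊤ ∧ IsBinomialIdeal J ∧ Induces J c) I

variable (k) in
/-- The binomial ideal `I_∼` associated to a congruence, in explicit form; see
`isAssociatedIdeal_iff` below for its characterization by maximality. -/
noncomputable def associatedIdeal (c : AddCon (Fin n →₀ ℕ)) : Ideal (MvPolynomial (Fin n) k) :=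
  Ideal.span ({f | ∃ u v : Fin n →₀ ℕ, c u v ∧ f = monomial u 1 - monomial v 1} ∪
    {f | ∃ e : Fin n →₀ ℕ, IsNil (e : c.Quotient) ∧ f = monomial e 1})

/-! ### The associated ideal is the one characterized by maximality -/

theorem IsNil.unique {S : Type*} [AddCommMonoid S] {x y : S} (hx : IsNil x) (hy : IsNil y) :
    x = y := by
  rw [← hx.2 y, add_comm, hy.2 x]

theorem coeff_mapDomain_monomial (c : AddCon (Fin n →₀ ℕ)) (u : Fin n →₀ ℕ) (t : k) :
    (AddMonoidAlgebra.mapDomainRingHom k c.mk' (monomial u t : MvPolynomial (Fin n) k)).coeff =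
      Finsupp.single (u : c.Quotient) t := by
  simp only [monomial, AddMonoidAlgebra.lsingle_apply,
    AddMonoidAlgebra.mapDomainRingHom_apply, AddMonoidAlgebra.mapDomain_single]
  rfl

theorem coeff_eq_zero_of_mem (c : AddCon (Fin n →₀ ℕ)) (f : MvPolynomial (Fin n) k)
    (hf : f ∈ associatedIdeal k c) (a : c.Quotient) (ha : ¬ IsNil a) :
    (AddMonoidAlgebra.mapDomainRingHom k c.mk' f).coeff a = 0 := by
  classical
  induction hf using Submodule.span_induction generalizing a with
  | mem f hf =>
    rcases hf with ⟨u, v, huv, rfl⟩ | ⟨e, he, rfl⟩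
    · have h : (u : c.Quotient) = v := (AddCon.eq c).2 huv
      rw [map_sub, AddMonoidAlgebra.coeff_sub, coeff_mapDomain_monomial,
        coeff_mapDomain_monomial, h, sub_self, Finsupp.zero_apply]
    · have h : (e : c.Quotient) ≠ a := fun h => ha (h ▸ he)
      rw [coeff_mapDomain_monomial, Finsupp.single_eq_of_ne h.symm]
  | zero => simp
  | add f g _ _ hf hg =>
    rw [map_add, AddMonoidAlgebra.coeff_add, Finsupp.add_apply, hf a ha, hg a ha, add_zero]
  | smul r f _ hf =>
    by_contra h
    rw [smul_eq_mul, map_mul] at h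
    have h1 := AddMonoidAlgebra.support_coeff_mul_subset _ _ (Finsupp.mem_support_iff.2 h)
    obtain ⟨x, -, y, hy, rfl⟩ := Finset.mem_add.1 h1
    have hy' : IsNil y := by
      by_contra hn
      exact (Finsupp.mem_support_iff.1 hy) (hf y hn)
    exact ha (by rw [hy'.2 x]; exact hy')

theorem isUnitalIdeal_associatedIdeal (c : AddCon (Fin n →₀ ℕ)) :
    IsUnitalIdeal (associatedIdeal k c) := by
  refine ⟨_, ?_, rfl⟩
  rintro f (⟨u, v, -, rfl⟩ | ⟨e, -, rfl⟩)
  · exact ⟨u, v, 1, Or.inr rfl, rfl⟩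
  · exact ⟨e, 0, 0, Or.inl rfl, by simp⟩

theorem IsUnitalIdeal.isBinomialIdeal {I : Ideal (MvPolynomial (Fin n) k)}
    (hI : IsUnitalIdeal I) : IsBinomialIdeal I := by
  obtain ⟨B, hB, rfl⟩ := hI
  refine ⟨B, fun f hf => ?_, rfl⟩
  obtain ⟨u, v, t, -, rfl⟩ := hB f hf
  exact ⟨u, v, 1, -t, by simp [sub_eq_add_neg]⟩

theorem associatedIdeal_ne_top (c : AddCon (Fin n →₀ ℕ)) : associatedIdeal k c ≠ ⊤ := by
  intro h
  have h1 : (monomial 0 1 : MvPolynomial (Fin n) k) ∈ associatedIdeal k c := h ▸ trivial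
  have h2 := coeff_eq_zero_of_mem c _ h1 0 (fun h => h.1 rfl)
  rw [coeff_mapDomain_monomial] at h2
  simp at h2

theorem induces_associatedIdeal (c : AddCon (Fin n →₀ ℕ)) :
    Induces (associatedIdeal k c) c := by
  intro u v
  constructor
  · intro h
    exact ⟨1, one_ne_zero, Ideal.subset_span (Or.inl ⟨u, v, h, rfl⟩)⟩
  · rintro ⟨t, ht, hm⟩
    have key := coeff_eq_zero_of_mem c _ hm
    simp only [map_sub, AddMonoidAlgebra.coeff_sub, coeff_mapDomain_monomial,
      Finsupp.sub_apply] at key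
    by_contra hne
    have hne' : (u : c.Quotient) ≠ v := fun h => hne ((AddCon.eq c).1 h)
    have hu : IsNil (u : c.Quotient) := by
      by_contra hn
      have := key _ hn
      simp [hne'.symm] at this
    have hv : IsNil (v : c.Quotient) := by
      by_contra hn
      have := key _ hn
      simp [hne', ht] at this
    exact hne' (hu.unique hv)

/-- The exponents of the monomials in a proper ideal inducing `c` are nil modulo `c`. -/
theorem isNil_of_monomial_mem {c : AddCon (Fin n →₀ ℕ)} {J : Ideal (MvPolynomial (Fin n) k)}
    (hJ : J ≠ ⊤) (hc : Induces J c) {e : Fin n →₀ ℕ} (he : monomial e 1 ∈ J) :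
    IsNil (e : c.Quotient) := by
  constructor
  · intro h
    obtain ⟨t, ht, hm⟩ := (hc e 0).1 ((AddCon.eq c).1 h)
    have h1 : (monomial 0 t : MvPolynomial (Fin n) k) ∈ J := by
      have := J.sub_mem he hm
      rwa [sub_sub_cancel] at this
    have h2 := J.mul_mem_left (C t⁻¹) h1
    rw [C_mul_monomial, inv_mul_cancel₀ ht] at h2
    exact hJ ((Ideal.eq_top_iff_one J).2 h2)
  · intro a
    induction a using AddCon.induction_on with
    | H a =>
      rw [← AddCon.coe_add, AddCon.eq]
      refine (hc _ _).2 ⟨1, one_ne_zero, J.sub_mem ?_ he⟩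
      have := J.mul_mem_left (monomial a 1) he
      rwa [monomial_mul, one_mul] at this

/-- The explicit ideal is the unique ideal with the maximality property. -/
theorem isAssociatedIdeal_iff (c : AddCon (Fin n →₀ ℕ))
    (I : Ideal (MvPolynomial (Fin n) k)) :
    IsAssociatedIdeal c I ↔ I = associatedIdeal k c := by
  have hA := isUnitalIdeal_associatedIdeal (k := k) c
  have hP : associatedIdeal k c ≠ ⊤ ∧ IsBinomialIdeal (associatedIdeal k c) ∧
      Induces (associatedIdeal k c) c :=
    ⟨associatedIdeal_ne_top c, hA.isBinomialIdeal, induces_associatedIdeal c⟩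
  constructor
  · rintro ⟨hu, hmax⟩
    obtain ⟨hne, -, hind⟩ := hmax.prop
    refine hmax.eq_of_le hP ?_
    obtain ⟨B, hB, hBI⟩ := id hu
    conv_lhs => rw [hBI]
    refine Ideal.span_le.2 fun f hf => ?_
    have hfI : f ∈ I := hBI ▸ Ideal.subset_span hf
    obtain ⟨u, v, t, rfl | rfl, rfl⟩ := hB f hf
    · simp only [map_zero, sub_zero] at hfI ⊢
      exact Ideal.subset_span (Or.inr ⟨u, isNil_of_monomial_mem hne hind hfI, rfl⟩)
    · exact Ideal.subset_span (Or.inl ⟨u, v, (hind u v).2 ⟨1, one_ne_zero, hfI⟩, rfl⟩)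
  · rintro rfl
    refine ⟨hA, hP, ?_⟩
    rintro K ⟨hne, ⟨B, hB, hBK⟩, hind⟩ hle
    have hmon : ∀ (u : Fin n →₀ ℕ) (t : k), monomial u t ∈ K →
        monomial u t ∈ associatedIdeal k c := by
      intro u t hm
      by_cases ht : t = 0
      · simp [ht]
      · have h2 := K.mul_mem_left (C t⁻¹) hm
        rw [C_mul_monomial, inv_mul_cancel₀ ht] at h2
        have h3 : (monomial u 1 : MvPolynomial (Fin n) k) ∈ associatedIdeal k c :=
          Ideal.subset_span (Or.inr ⟨u, isNil_of_monomial_mem hne hind h2, rfl⟩)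
        have h4 := (associatedIdeal k c).mul_mem_left (C t) h3
        rwa [C_mul_monomial, mul_one] at h4
    rw [hBK]
    refine Ideal.span_le.2 fun f hf => ?_
    have hfK : f ∈ K := hBK ▸ Ideal.subset_span hf
    obtain ⟨u, v, a, b, rfl⟩ := hB f hf
    by_cases ha : a = 0
    · simp only [ha, map_zero, zero_add] at hfK ⊢
      exact hmon _ _ hfK
    by_cases hb : b = 0
    · simp only [hb, map_zero, add_zero] at hfK ⊢
      exact hmon _ _ hfK
    have huv : c u v := by
      refine (hind u v).2 ⟨-(a⁻¹ * b), by simp [ha, hb], ?_⟩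
      have := K.mul_mem_left (C a⁻¹) hfK
      rw [mul_add, C_mul_monomial, C_mul_monomial, inv_mul_cancel₀ ha] at this
      simpa using this
    have h1 : (monomial u 1 - monomial v 1 : MvPolynomial (Fin n) k) ∈ associatedIdeal k c :=
      Ideal.subset_span (Or.inl ⟨u, v, huv, rfl⟩)
    have h2 := (associatedIdeal k c).mul_mem_left (C a) h1
    rw [mul_sub, C_mul_monomial, C_mul_monomial, mul_one] at h2
    have h3 : (monomial u a + monomial v b : MvPolynomial (Fin n) k) =
        (monomial u a - monomial v a) + monomial v (a + b) := by
      rw [map_add]; ring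
    have h4 : (monomial v (a + b) : MvPolynomial (Fin n) k) ∈ K := by
      have := K.sub_mem hfK (hle h2)
      rwa [h3, add_sub_cancel_left] at this
    change monomial u a + monomial v b ∈ associatedIdeal k c
    rw [h3]
    exact add_mem h2 (hmon _ _ h4)

/-! ### Cellular, mesoprime and mesoprimary ideals -/

/-- `I` is a proper ideal modulo which the variables `X_i`, `i ∈ δ`, are nonzerodivisors and the
other variables are nilpotent. -/
def IsCellularWrt (δ : Set (Fin n)) (I : Ideal (MvPolynomial (Fin n) k)) : Prop :=
  I ≠ ⊤ ∧ (∀ i ∈ δ, I.colon {X i} = I) ∧ ∀ i ∉ δ, ∃ d : ℕ, X i ^ d ∈ I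

/-- `I` is cellular with respect to some set of variables. -/
def IsCellular (I : Ideal (MvPolynomial (Fin n) k)) : Prop :=
  ∃ δ : Set (Fin n), IsCellularWrt δ I

/-- The difference `u - v` in `ℤⁿ` of two exponents. -/
def expDiff (u v : Fin n →₀ ℕ) : Fin n → ℤ := fun i => (u i : ℤ) - (v i : ℤ)

/-- The lattice ideal `I_L(ρ)`, generated by the binomials `X^u - ρ(u - v) X^v` with
`u - v ∈ L`. -/
noncomputable def latticeIdeal (L : AddSubgroup (Fin n → ℤ)) (ρ : Multiplicative L →* kˣ) :
    Ideal (MvPolynomial (Fin n) k) :=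
  Ideal.span {f | ∃ (u v : Fin n →₀ ℕ) (h : expDiff u v ∈ L),
    f = monomial u 1 -
      monomial v ((ρ (Multiplicative.ofAdd (⟨expDiff u v, h⟩ : L)) : kˣ) : k)}

/-- The extension to `k[X]` of the ideal `I ∩ k[X_i : i ∈ δ]`. -/
noncomputable def restrictExtend (δ : Set (Fin n)) (I : Ideal (MvPolynomial (Fin n) k)) :
    Ideal (MvPolynomial (Fin n) k) :=
  Ideal.span {f | f ∈ I ∧ f ∈ supported k δ}

/-- `P` is a mesoprime associated to the `δ`-cellular ideal `I`: it has the form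
`I_L(ρ) + ⟨X_j : j ∉ δ⟩` for a subgroup `L` of `ℤ^δ` and a character `ρ` of `L` such that
`((I : X^u) ∩ k[X_i : i ∈ δ]) k[X] = I_L(ρ)` for some monomial `X^u` in the variables `X_j`,
`j ∉ δ`. -/
def IsAssociatedMesoprime (δ : Set (Fin n)) (I P : Ideal (MvPolynomial (Fin n) k)) : Prop :=
  ∃ (L : AddSubgroup (Fin n → ℤ)) (ρ : Multiplicative L →* kˣ),
    (∀ w ∈ L, ∀ i ∉ δ, w i = 0) ∧
    P = latticeIdeal L ρ ⊔ Ideal.span {f | ∃ j ∉ δ, f = X j} ∧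
    ∃ u : Fin n →₀ ℕ, (∀ i ∈ δ, u i = 0) ∧
      restrictExtend δ (I.colon {monomial u 1}) = latticeIdeal L ρ

/-- A cellular binomial ideal with exactly one associated mesoprime. -/
def IsMesoprimaryIdeal (I : Ideal (MvPolynomial (Fin n) k)) : Prop :=
  IsBinomialIdeal I ∧
    ∃ δ : Set (Fin n), IsCellularWrt δ I ∧
      ∃! P : Ideal (MvPolynomial (Fin n) k), IsAssociatedMesoprime δ I P

variable (k) in
/-- The congruence `c` is primary: its associated ideal is cellular. -/
def IsPrimaryCongruence (c : AddCon (Fin n →₀ ℕ)) : Prop :=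
  IsCellular (associatedIdeal k c)

variable (k) in
/-- The congruence `c` is mesoprimary: its associated ideal is mesoprimary. -/
def IsMesoprimaryCongruence (c : AddCon (Fin n →₀ ℕ)) : Prop :=
  IsMesoprimaryIdeal (associatedIdeal k c)

end Ideals

end BinomialCongruence

/-!
Write `I` for the associated ideal of the congruence `∼`. A monomial `X^u` lies in `I` exactly when
`[u]` is nil, and a polynomial of `I` has vanishing coefficient sum over every non-nil class
(`coeff_eq_zero_of_mem`). Suppose that `I` is `δ`-cellular.

* The variables `X_i`, `i ∈ δ`, are nonzerodivisors modulo `I` and the others are nilpotent, so the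
  cancellable classes are exactly the classes of exponents supported on `δ`
  (`IsCellularWrt.isCancellable_iff`).
* For an exponent `u`, let `L_u` be the lattice of differences `a - b` of exponents supported on `δ`
  with `u + a ∼ u + b` (`translationLattice`). If `[u]` is not nil, then the ideal
  `((I : X^u) ∩ k[X_i : i ∈ δ]) k[X]` is the lattice ideal of `L_u` with trivial character
  (`IsCellularWrt.restrictExtend_colon_eq`); if `[u]` is nil, it is the unit ideal, which is never
  a lattice ideal (`latticeIdeal_ne_top`).
* The ideal `I_L(ρ) + ⟨X_j : j ∉ δ⟩` determines `L` (`expDiff_mem_of_binomial_mem`): a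
  linear functional that vanishes on it and reads off the character on one coset of `L` separates
  the binomials with difference outside `L`.

Hence the associated mesoprimes are indexed by the lattices `L_u` with `[u]` not nil, and `I` is
mesoprimary if and only if `L_u = L_0` for all these `u`. Since `L_0` consists of the differences
`a - b` with `a ∼ b`, this equality says that `u + a ∼ u + b` implies `a ∼ b` for exponents `a`, `b`
supported on `δ`, which is partial cancellability of `[u]`.
-/

namespace BinomialCongruence

open MvPolynomial

/-! ### Nil and cancellable elements -/

section Monoid

variable {S : Type*} [AddCommMonoid S]

/-- The submonoid of cancellable elements. -/
def cancellableSubmonoid (S : Type*) [AddCommMonoid S] : AddSubmonoid S where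
  carrier := {a | IsCancellable a}
  zero_mem' := fun b c h => by simpa using h
  add_mem' := fun {x y} hx hy b c h => hx _ _ (hy _ _ (by simpa only [add_assoc] using h))

theorem IsNil.add_left {x : S} (hx : IsNil x) (a : S) : IsNil (a + x) := by
  rwa [hx.2 a]

theorem IsCancellable.not_isNil {a : S} (ha : IsCancellable a) : ¬ IsNil a := fun h =>
  h.1 (ha a 0 (by rw [h.2 a, zero_add]))

theorem IsCancellable.of_add_right {x b : S} (h : IsCancellable (x + b)) : IsCancellable b :=
  fun y z hyz => h y z (by rw [add_left_comm, hyz, add_left_comm])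

theorem IsNil.of_add_cancellable {x b : S} (hb : IsCancellable b) (h : IsNil (x + b)) :
    IsNil x := by
  refine ⟨?_, fun a => hb _ _ (by rw [add_assoc, h.2])⟩
  rintro rfl
  rw [zero_add] at h
  exact hb.not_isNil h

end Monoid

/-! ### Exponents and their differences -/

section Exponents

variable {n : ℕ}

/-- The exponent `u` lies in `ℕ^δ`: its coordinates outside `δ` vanish. -/
def IsSupportedOn (δ : Set (Fin n)) (u : Fin n →₀ ℕ) : Prop := ∀ i ∉ δ, u i = 0

theorem IsSupportedOn.add {δ : Set (Fin n)} {u v : Fin n →₀ ℕ} (hu : IsSupportedOn δ u)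
    (hv : IsSupportedOn δ v) : IsSupportedOn δ (u + v) := fun i hi => by
  rw [Finsupp.add_apply, hu i hi, hv i hi]

theorem isSupportedOn_zero (δ : Set (Fin n)) : IsSupportedOn δ 0 := fun _ _ => rfl

/-- Every exponent is the sum of an exponent vanishing on `δ` and one supported on `δ`. -/
theorem exists_eq_add_isSupportedOn (δ : Set (Fin n)) (x : Fin n →₀ ℕ) :
    ∃ u z : Fin n →₀ ℕ, x = u + z ∧ (∀ i ∈ δ, u i = 0) ∧ IsSupportedOn δ z := by
  classical
  refine ⟨x.filter (fun i => ¬ i ∈ δ), x.filter (· ∈ δ), ?_, fun i hi => ?_, fun i hi => ?_⟩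
  · rw [add_comm, Finsupp.filter_add_filter_not]
  · exact Finsupp.filter_apply_neg _ _ (not_not.2 hi)
  · exact Finsupp.filter_apply_neg _ _ hi

theorem expDiff_eq_iff {a b c d : Fin n →₀ ℕ} : expDiff a b = expDiff c d ↔ a + d = c + b := by
  simp only [funext_iff, expDiff, Finsupp.ext_iff, Finsupp.add_apply]
  exact forall_congr' fun i => by omega

theorem expDiff_self (a : Fin n →₀ ℕ) : expDiff a a = 0 := by
  funext i
  simp [expDiff]

theorem expDiff_add_left (w a b : Fin n →₀ ℕ) : expDiff (w + a) (w + b) = expDiff a b :=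
  expDiff_eq_iff.2 (by abel)

theorem expDiff_add_expDiff (a b c : Fin n →₀ ℕ) :
    expDiff a b + expDiff b c = expDiff a c := by
  funext i
  simp [expDiff]

/-- The lattice of differences `a - b` of exponents supported on `δ` whose translates by `u` are
congruent. -/
def translationLattice (c : AddCon (Fin n →₀ ℕ)) (δ : Set (Fin n)) (u : Fin n →₀ ℕ) :
    AddSubgroup (Fin n → ℤ) where
  carrier := {w | ∃ a b, IsSupportedOn δ a ∧ IsSupportedOn δ b ∧ c (u + a) (u + b) ∧
    w = expDiff a b}
  zero_mem' := ⟨0, 0, isSupportedOn_zero δ, isSupportedOn_zero δ, c.refl _, (expDiff_self 0).symm⟩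
  add_mem' := by
    rintro _ _ ⟨a, b, ha, hb, h, rfl⟩ ⟨a', b', ha', hb', h', rfl⟩
    refine ⟨a + a', b + b', ha.add ha', hb.add hb', ?_, ?_⟩
    · have h1 := c.add h (c.refl a')
      have h2 := c.add h' (c.refl b)
      rw [add_right_comm, add_right_comm u b'] at h2
      simpa only [add_assoc] using c.trans h1 h2
    · funext i
      simp only [Pi.add_apply, expDiff, Finsupp.add_apply]
      push_cast
      ring
  neg_mem' := by
    rintro _ ⟨a, b, ha, hb, h, rfl⟩
    refine ⟨b, a, hb, ha, c.symm h, ?_⟩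
    funext i
    simp [expDiff]

theorem apply_eq_zero_of_mem_translationLattice {c : AddCon (Fin n →₀ ℕ)} {δ : Set (Fin n)}
    {u : Fin n →₀ ℕ} {w : Fin n → ℤ} (hw : w ∈ translationLattice c δ u) {i : Fin n}
    (hi : i ∉ δ) : w i = 0 := by
  obtain ⟨a, b, ha, hb, -, rfl⟩ := hw
  simp [expDiff, ha i hi, hb i hi]

end Exponents

section Ideals

variable {k : Type*} [Field k] {n : ℕ}

/-! ### A functional separating the cosets of a lattice -/

theorem map_eq_zero_of_mem_span {S : Set (MvPolynomial (Fin n) k)}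
    (φ : MvPolynomial (Fin n) k →ₗ[k] k) (h : ∀ s ∈ S, ∀ w, φ (monomial w 1 * s) = 0)
    {f : MvPolynomial (Fin n) k} (hf : f ∈ Ideal.span S) : φ f = 0 := by
  -- The kernel of `φ` is not an ideal, so the induction runs over all multiples of `f`.
  suffices H : ∀ r, φ (r * f) = 0 by simpa using H 1
  induction hf using Submodule.span_induction with
  | mem s hs =>
    intro r
    induction r using MvPolynomial.induction_on' with
    | monomial w t =>
      have ht : (monomial w t : MvPolynomial (Fin n) k) = t • monomial w 1 := by
        rw [smul_monomial, smul_eq_mul, mul_one]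
      rw [ht, smul_mul_assoc, map_smul, h s hs w, smul_zero]
    | add p q hp hq => rw [add_mul, map_add, hp, hq, add_zero]
  | zero => intro r; rw [mul_zero, map_zero]
  | add f g _ _ hf hg => intro r; rw [mul_add, map_add, hf, hg, add_zero]
  | smul p f _ hf => intro r; rw [smul_eq_mul, ← mul_assoc, hf]

/-- The linear functional sending `X^x` to `ρ(x - b)` if `x` is supported on `δ` and `x - b ∈ L`,
and to `0` otherwise. -/
noncomputable def cosetFunctional (δ : Set (Fin n)) (L : AddSubgroup (Fin n → ℤ))
    (ρ : Multiplicative L →* kˣ) (b : Fin n →₀ ℕ) : MvPolynomial (Fin n) k →ₗ[k] k :=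
  open Classical in
  (basisMonomials (Fin n) k).constr k fun x =>
    if h : IsSupportedOn δ x ∧ expDiff x b ∈ L then
      ((ρ (Multiplicative.ofAdd (⟨expDiff x b, h.2⟩ : L)) : kˣ) : k) else 0

theorem cosetFunctional_monomial (δ : Set (Fin n)) (L : AddSubgroup (Fin n → ℤ))
    (ρ : Multiplicative L →* kˣ) (b x : Fin n →₀ ℕ) (t : k)
    [Decidable (IsSupportedOn δ x ∧ expDiff x b ∈ L)] :
    cosetFunctional δ L ρ b (monomial x t) = t *
      if h : IsSupportedOn δ x ∧ expDiff x b ∈ L then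
        ((ρ (Multiplicative.ofAdd (⟨expDiff x b, h.2⟩ : L)) : kˣ) : k) else 0 := by
  have h1 : (monomial x t : MvPolynomial (Fin n) k) = t • basisMonomials (Fin n) k x := by
    rw [coe_basisMonomials, smul_monomial, smul_eq_mul, mul_one]
  rw [h1, map_smul, cosetFunctional, Module.Basis.constr_basis, smul_eq_mul]
  congr

theorem cosetFunctional_eq_zero_of_mem {δ : Set (Fin n)} {L : AddSubgroup (Fin n → ℤ)}
    (hL : ∀ w ∈ L, ∀ i ∉ δ, w i = 0) (ρ : Multiplicative L →* kˣ) (b : Fin n →₀ ℕ)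
    {f : MvPolynomial (Fin n) k}
    (hf : f ∈ latticeIdeal L ρ ⊔ Ideal.span {f | ∃ j ∉ δ, f = X j}) :
    cosetFunctional δ L ρ b f = 0 := by
  classical
  rw [latticeIdeal, ← Ideal.span_union] at hf
  refine map_eq_zero_of_mem_span _ ?_ hf
  rintro s (⟨u, v, h, rfl⟩ | ⟨j, hj, rfl⟩) w
  · rw [mul_sub, monomial_mul, monomial_mul, map_sub, cosetFunctional_monomial,
      cosetFunctional_monomial]
    have hdiff : expDiff (w + u) (w + v) ∈ L := by rwa [expDiff_add_left]
    have hsum : expDiff (w + u) b = expDiff u v + expDiff (w + v) b := by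
      rw [← expDiff_add_left w u v, expDiff_add_expDiff]
    have hiff : (IsSupportedOn δ (w + u) ∧ expDiff (w + u) b ∈ L) ↔
        (IsSupportedOn δ (w + v) ∧ expDiff (w + v) b ∈ L) := by
      rw [hsum, L.add_mem_cancel_left h]
      refine and_congr_left fun _ => forall_congr' fun i => forall_congr' fun hi => ?_
      have := hL _ hdiff i hi
      simp only [expDiff] at this
      omega
    by_cases h1 : IsSupportedOn δ (w + u) ∧ expDiff (w + u) b ∈ L
    · have h2 := hiff.1 h1
      have h3 : (⟨expDiff (w + u) b, h1.2⟩ : L) = ⟨expDiff u v, h⟩ + ⟨expDiff (w + v) b, h2.2⟩ :=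
        Subtype.ext hsum
      rw [dif_pos h1, dif_pos h2, h3, ofAdd_add, map_mul, Units.val_mul]
      ring
    · rw [dif_neg h1, dif_neg (fun h2 => h1 (hiff.2 h2)), mul_zero, mul_zero, sub_zero]
  · have hX : (monomial w 1 * X j : MvPolynomial (Fin n) k) =
        monomial (w + Finsupp.single j 1) 1 := by
      rw [X, monomial_mul, one_mul]
    rw [hX, cosetFunctional_monomial, dif_neg, mul_zero]
    intro h
    have := h.1 j hj
    simp at this

/-- A binomial with exponents supported on `δ` in `I_L(ρ) + ⟨X_j : j ∉ δ⟩` has its difference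
in `L`. -/
theorem expDiff_mem_of_binomial_mem {δ : Set (Fin n)} {L : AddSubgroup (Fin n → ℤ)}
    (hL : ∀ w ∈ L, ∀ i ∉ δ, w i = 0) (ρ : Multiplicative L →* kˣ) {a b : Fin n →₀ ℕ}
    (hb : IsSupportedOn δ b)
    (h : (monomial a 1 - monomial b 1 : MvPolynomial (Fin n) k) ∈
      latticeIdeal L ρ ⊔ Ideal.span {f | ∃ j ∉ δ, f = X j}) :
    expDiff a b ∈ L := by
  classical
  by_contra hab
  have h1 := cosetFunctional_eq_zero_of_mem hL ρ b h
  have h0 : expDiff b b ∈ L := by rw [expDiff_self]; exact L.zero_mem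
  rw [map_sub, cosetFunctional_monomial, cosetFunctional_monomial, dif_neg (fun h => hab h.2),
    dif_pos ⟨hb, h0⟩] at h1
  simp at h1

theorem latticeIdeal_ne_top {δ : Set (Fin n)} {L : AddSubgroup (Fin n → ℤ)}
    (hL : ∀ w ∈ L, ∀ i ∉ δ, w i = 0) (ρ : Multiplicative L →* kˣ) : latticeIdeal L ρ ≠ ⊤ := by
  classical
  intro h
  have h1 : (monomial 0 1 : MvPolynomial (Fin n) k) ∈
      latticeIdeal L ρ ⊔ Ideal.span {f | ∃ j ∉ δ, f = X j} := by
    rw [h, top_sup_eq]; trivial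
  have h2 := cosetFunctional_eq_zero_of_mem hL ρ 0 h1
  have h0 : expDiff (0 : Fin n →₀ ℕ) 0 ∈ L := by rw [expDiff_self]; exact L.zero_mem
  rw [cosetFunctional_monomial, dif_pos ⟨isSupportedOn_zero δ, h0⟩] at h2
  simp at h2

/-! ### Cellular associated ideals -/

theorem monomial_mem_associatedIdeal_iff {c : AddCon (Fin n →₀ ℕ)} {e : Fin n →₀ ℕ} :
    monomial e 1 ∈ associatedIdeal k c ↔ IsNil (e : c.Quotient) :=
  ⟨isNil_of_monomial_mem (associatedIdeal_ne_top c) (induces_associatedIdeal c),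
    fun h => Ideal.subset_span (Or.inr ⟨e, h, rfl⟩)⟩

theorem binomial_mem_associatedIdeal_iff {c : AddCon (Fin n →₀ ℕ)} {u v : Fin n →₀ ℕ} :
    monomial u 1 - monomial v 1 ∈ associatedIdeal k c ↔ c u v :=
  ⟨fun h => (induces_associatedIdeal c u v).2 ⟨1, one_ne_zero, h⟩,
    fun h => Ideal.subset_span (Or.inl ⟨u, v, h, rfl⟩)⟩

variable {c : AddCon (Fin n →₀ ℕ)} {δ : Set (Fin n)}

theorem IsCellularWrt.isCancellable_single (hδ : IsCellularWrt δ (associatedIdeal k c))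
    {i : Fin n} (hi : i ∈ δ) : IsCancellable ((Finsupp.single i 1 : Fin n →₀ ℕ) : c.Quotient) := by
  intro x y
  induction x using AddCon.induction_on with
  | H x =>
  induction y using AddCon.induction_on with
  | H y =>
  rw [← AddCon.coe_add, ← AddCon.coe_add, AddCon.eq, AddCon.eq]
  intro h
  rw [← binomial_mem_associatedIdeal_iff (k := k)] at h ⊢
  rw [← hδ.2.1 i hi, Submodule.mem_colon_singleton, smul_eq_mul, sub_mul, X, monomial_mul,
    monomial_mul, one_mul]
  exact h

/-- Modulo a congruence with `δ`-cellular associated ideal, the cancellable elements are the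
classes of exponents supported on `δ`. -/
theorem IsCellularWrt.isCancellable_iff (hδ : IsCellularWrt δ (associatedIdeal k c))
    {z : Fin n →₀ ℕ} : IsCancellable (z : c.Quotient) ↔ IsSupportedOn δ z := by
  constructor
  · intro hz i hi
    by_contra hzi
    obtain ⟨d, hd⟩ := hδ.2.2 i hi
    rw [X_pow_eq_monomial, monomial_mem_associatedIdeal_iff] at hd
    have h1 : IsCancellable ((Finsupp.single i 1 : Fin n →₀ ℕ) : c.Quotient) := by
      have h2 : z = (z - Finsupp.single i 1) + Finsupp.single i 1 :=
        (tsub_add_cancel_of_le (Finsupp.single_le_iff.2 (Nat.one_le_iff_ne_zero.2 hzi))).symm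
      rw [h2, AddCon.coe_add] at hz
      exact hz.of_add_right
    have h3 : IsCancellable ((Finsupp.single i d : Fin n →₀ ℕ) : c.Quotient) := by
      have := (cancellableSubmonoid c.Quotient).nsmul_mem h1 d
      have hd' : d • Finsupp.single i 1 = Finsupp.single i d := by
        rw [Finsupp.smul_single, smul_eq_mul, mul_one]
      rw [← hd']
      exact this
    exact h3.not_isNil hd
  · intro hz
    have h : z ∈ (cancellableSubmonoid c.Quotient).comap c.mk' := by
      rw [← Finsupp.sum_single z]
      refine AddSubmonoid.sum_mem _ fun i hi => ?_
      have hiδ : i ∈ δ := by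
        by_contra h
        exact Finsupp.mem_support_iff.1 hi (hz i h)
      have h1 : Finsupp.single i 1 ∈ (cancellableSubmonoid c.Quotient).comap c.mk' :=
        hδ.isCancellable_single hiδ
      have := AddSubmonoid.nsmul_mem _ h1 (z i)
      rwa [Finsupp.smul_single, smul_eq_mul, mul_one] at this
    exact h

theorem IsCellularWrt.rel_of_add (hδ : IsCellularWrt δ (associatedIdeal k c))
    {x y z : Fin n →₀ ℕ} (hz : IsSupportedOn δ z) (h : c (x + z) (y + z)) : c x y := by
  rw [← AddCon.eq] at h ⊢
  exact hδ.isCancellable_iff.2 hz _ _ h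

theorem IsCellularWrt.expDiff_mem_translationLattice_iff
    (hδ : IsCellularWrt δ (associatedIdeal k c)) {u a b : Fin n →₀ ℕ}
    (ha : IsSupportedOn δ a) (hb : IsSupportedOn δ b) :
    expDiff a b ∈ translationLattice c δ u ↔ c (u + a) (u + b) := by
  refine ⟨?_, fun h => ⟨a, b, ha, hb, h, rfl⟩⟩
  rintro ⟨a', b', ha', hb', h, hab⟩
  refine hδ.rel_of_add hb' ?_
  rw [expDiff_eq_iff] at hab
  have h1 := c.add h (c.refl b)
  rwa [add_assoc, ← hab, ← add_assoc, add_right_comm u b'] at h1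

/-! ### The mesoprimes of a cellular associated ideal -/

theorem IsSupportedOn.monomial_mem_supported {a : Fin n →₀ ℕ} (ha : IsSupportedOn δ a) (t : k) :
    monomial a t ∈ supported k δ := by
  rw [mem_supported]
  intro i hi
  obtain ⟨d, hd, hid⟩ := (mem_vars_iff_mem_support i).1 hi
  rw [Finset.mem_singleton.1 (support_monomial_subset hd)] at hid
  by_contra h
  exact Finsupp.mem_support_iff.1 hid (ha i h)

theorem isSupportedOn_of_mem_support {f : MvPolynomial (Fin n) k} (hf : f ∈ supported k δ)
    {a : Fin n →₀ ℕ} (ha : a ∈ f.support) : IsSupportedOn δ a := by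
  intro i hi
  by_contra h
  exact hi (mem_supported.1 hf
    ((mem_vars_iff_mem_support i).2 ⟨a, ha, Finsupp.mem_support_iff.2 h⟩))

theorem latticeIdeal_translationLattice_le (hδ : IsCellularWrt δ (associatedIdeal k c))
    (u : Fin n →₀ ℕ) :
    latticeIdeal (translationLattice c δ u) (1 : _ →* kˣ) ≤
      restrictExtend δ ((associatedIdeal k c).colon {monomial u 1}) := by
  refine Ideal.span_le.2 ?_
  rintro _ ⟨x, y, h, rfl⟩
  obtain ⟨p, a, rfl, hp, ha⟩ := exists_eq_add_isSupportedOn δ x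
  obtain ⟨q, b, rfl, hq, hb⟩ := exists_eq_add_isSupportedOn δ y
  -- The difference lies in `ℤ^δ`, so both exponents have the same part outside `δ`.
  have hpq : p = q := by
    ext i
    by_cases hi : i ∈ δ
    · rw [hp i hi, hq i hi]
    · have := apply_eq_zero_of_mem_translationLattice h hi
      simp only [expDiff, Finsupp.add_apply, ha i hi, hb i hi] at this
      omega
  subst hpq
  have hab := (hδ.expDiff_mem_translationLattice_iff ha hb).1 (expDiff_add_left p a b ▸ h)
  have hmem : (monomial a 1 - monomial b 1 : MvPolynomial (Fin n) k) ∈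
      restrictExtend δ ((associatedIdeal k c).colon {monomial u 1}) := by
    refine Ideal.subset_span ⟨?_, sub_mem (ha.monomial_mem_supported 1)
      (hb.monomial_mem_supported 1)⟩
    rw [Submodule.mem_colon_singleton, smul_eq_mul, mul_comm, mul_sub, monomial_mul, monomial_mul,
      one_mul]
    exact binomial_mem_associatedIdeal_iff.2 hab
  have := Ideal.mul_mem_left _ (monomial p 1) hmem
  rw [mul_sub, monomial_mul, monomial_mul, one_mul] at this
  simpa using this

/-- If `X^u f ∈ I` with `f` in the variables from `δ` and `[u]` not nil, then the coefficients of
`f` sum to zero over each class of exponents `a` with a fixed value of `[u + a]`, so `f` is a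
combination of binomials `X^a - X^b` with `u + a ∼ u + b`. -/
theorem restrictExtend_colon_le (hδ : IsCellularWrt δ (associatedIdeal k c))
    {u : Fin n →₀ ℕ} (hu : ¬ IsNil (u : c.Quotient)) :
    restrictExtend δ ((associatedIdeal k c).colon {monomial u 1}) ≤
      latticeIdeal (translationLattice c δ u) (1 : _ →* kˣ) := by
  classical
  refine Ideal.span_le.2 ?_
  rintro f ⟨hf, hfδ⟩
  rw [Submodule.mem_colon_singleton, smul_eq_mul] at hf
  set J := latticeIdeal (translationLattice c δ u) (1 : _ →* kˣ)
  have hsupp := fun a (ha : a ∈ f.support) => isSupportedOn_of_mem_support hfδ ha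
  have hsum : ∑ a ∈ f.support, Finsupp.single ((u + a : Fin n →₀ ℕ) : c.Quotient) (coeff a f) =
      0 := by
    have hfu : f * monomial u 1 = ∑ a ∈ f.support, monomial (u + a) (coeff a f) := by
      conv_lhs => rw [f.as_sum, Finset.sum_mul]
      exact Finset.sum_congr rfl fun a _ => by rw [monomial_mul, mul_one, add_comm]
    ext q
    by_cases hq : IsNil q
    · rw [Finsupp.finsetSum_apply, Finsupp.zero_apply]
      refine Finset.sum_eq_zero fun a ha => Finsupp.single_eq_of_ne ?_
      rintro rfl
      rw [AddCon.coe_add] at hq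
      exact hu (hq.of_add_cancellable (hδ.isCancellable_iff.2 (hsupp a ha)))
    · have := coeff_eq_zero_of_mem c _ hf q hq
      rw [hfu, map_sum, AddMonoidAlgebra.coeff_sum] at this
      simp only [coeff_mapDomain_monomial] at this
      exact this
  -- `X^a` modulo `J` depends only on `[u + a]` for `a` supported on `δ`.
  let g : c.Quotient → MvPolynomial (Fin n) k ⧸ J := fun q =>
    if h : ∃ a, IsSupportedOn δ a ∧ ((u + a : Fin n →₀ ℕ) : c.Quotient) = q then
      Ideal.Quotient.mk J (monomial h.choose 1) else 0
  have hg : ∀ a, IsSupportedOn δ a →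
      g ((u + a : Fin n →₀ ℕ) : c.Quotient) = Ideal.Quotient.mk J (monomial a 1) := by
    intro a ha
    have h : ∃ b, IsSupportedOn δ b ∧
        ((u + b : Fin n →₀ ℕ) : c.Quotient) = ((u + a : Fin n →₀ ℕ) : c.Quotient) := ⟨a, ha, rfl⟩
    simp only [g]
    rw [dif_pos h, Ideal.Quotient.eq]
    refine Ideal.subset_span ⟨h.choose, a, ⟨_, _, h.choose_spec.1, ha,
      (AddCon.eq c).1 h.choose_spec.2, rfl⟩, ?_⟩
    simp
  have h1 := congrArg (Finsupp.linearCombination k g) hsum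
  rw [map_sum, map_zero] at h1
  rw [SetLike.mem_coe, ← Ideal.Quotient.eq_zero_iff_mem, ← h1]
  conv_lhs => rw [f.as_sum, map_sum]
  refine Finset.sum_congr rfl fun a ha => ?_
  rw [Finsupp.linearCombination_single, hg a (hsupp a ha), ← Ideal.Quotient.mkₐ_eq_mk k,
    ← map_smul, smul_monomial, smul_eq_mul, mul_one]

theorem IsCellularWrt.restrictExtend_colon_eq (hδ : IsCellularWrt δ (associatedIdeal k c))
    {u : Fin n →₀ ℕ} (hu : ¬ IsNil (u : c.Quotient)) :
    restrictExtend δ ((associatedIdeal k c).colon {monomial u 1}) =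
      latticeIdeal (translationLattice c δ u) (1 : _ →* kˣ) :=
  le_antisymm (restrictExtend_colon_le hδ hu) (latticeIdeal_translationLattice_le hδ u)

theorem restrictExtend_colon_eq_top {u : Fin n →₀ ℕ} (hu : IsNil (u : c.Quotient)) :
    restrictExtend δ ((associatedIdeal k c).colon {monomial u 1}) = ⊤ := by
  refine (Ideal.eq_top_iff_one _).2 (Ideal.subset_span ⟨?_, one_mem _⟩)
  rw [Submodule.mem_colon_singleton, one_smul]
  exact monomial_mem_associatedIdeal_iff.2 hu

/-- The associated mesoprimes of a cellular associated ideal are those of the lattices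
`L_u` with `[u]` not nil. -/
theorem IsCellularWrt.isAssociatedMesoprime_iff (hδ : IsCellularWrt δ (associatedIdeal k c))
    {P : Ideal (MvPolynomial (Fin n) k)} :
    IsAssociatedMesoprime δ (associatedIdeal k c) P ↔
      ∃ u : Fin n →₀ ℕ, (∀ i ∈ δ, u i = 0) ∧ ¬ IsNil (u : c.Quotient) ∧
        P = latticeIdeal (translationLattice c δ u) (1 : _ →* kˣ) ⊔
          Ideal.span {f | ∃ j ∉ δ, f = X j} := by
  constructor
  · rintro ⟨L, ρ, hL, rfl, u, huδ, hu⟩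
    have hnil : ¬ IsNil (u : c.Quotient) := fun h =>
      latticeIdeal_ne_top hL ρ (by rw [← hu, restrictExtend_colon_eq_top h])
    exact ⟨u, huδ, hnil, by rw [← hu, hδ.restrictExtend_colon_eq hnil]⟩
  · rintro ⟨u, huδ, hnil, rfl⟩
    exact ⟨translationLattice c δ u, 1,
      fun w hw i hi => apply_eq_zero_of_mem_translationLattice hw hi, rfl, u, huδ,
      hδ.restrictExtend_colon_eq hnil⟩

/-! ### Partial cancellability and uniqueness of the mesoprime -/

theorem not_isNil_coe_zero : ¬ IsNil ((0 : Fin n →₀ ℕ) : c.Quotient) := fun h => h.1 rfl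

theorem IsCellularWrt.isPartlyCancellable_of_subsingleton
    (hδ : IsCellularWrt δ (associatedIdeal k c))
    (h : ∀ P Q, IsAssociatedMesoprime δ (associatedIdeal k c) P →
      IsAssociatedMesoprime δ (associatedIdeal k c) Q → P = Q) (q : c.Quotient) :
    IsPartlyCancellable q := by
  intro b' c'
  induction q using AddCon.induction_on with
  | H x =>
  induction b' using AddCon.induction_on with
  | H a =>
  induction c' using AddCon.induction_on with
  | H b =>
  rw [hδ.isCancellable_iff, hδ.isCancellable_iff, ← AddCon.coe_add, ← AddCon.coe_add, AddCon.eq,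
    AddCon.eq]
  intro ha hb hab hnil
  -- The part of `x` supported on `δ` is cancellable, so only the part `u` off `δ` matters.
  obtain ⟨u, z, rfl, hu, hz⟩ := exists_eq_add_isSupportedOn δ x
  have hu' : ¬ IsNil (u : c.Quotient) := by
    intro h
    refine hnil ?_
    rw [add_assoc, add_comm, AddCon.coe_add]
    exact h.add_left _
  rw [add_right_comm, add_right_comm u z] at hab
  have hab' := hδ.rel_of_add hz hab
  have hP := h _ _ (hδ.isAssociatedMesoprime_iff.2 ⟨u, hu, hu', rfl⟩)
    (hδ.isAssociatedMesoprime_iff.2 ⟨0, fun _ _ => rfl, not_isNil_coe_zero, rfl⟩)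
  have hmem : (monomial a 1 - monomial b 1 : MvPolynomial (Fin n) k) ∈
      latticeIdeal (translationLattice c δ u) (1 : _ →* kˣ) ⊔
        Ideal.span {f | ∃ j ∉ δ, f = X j} := by
    refine Ideal.mem_sup_left (Ideal.subset_span ⟨a, b, ⟨a, b, ha, hb, hab', rfl⟩, ?_⟩)
    simp
  rw [hP] at hmem
  have h0 := expDiff_mem_of_binomial_mem
    (fun w hw i hi => apply_eq_zero_of_mem_translationLattice hw hi) _ hb hmem
  simpa only [zero_add] using (hδ.expDiff_mem_translationLattice_iff ha hb).1 h0

theorem IsCellularWrt.translationLattice_eq (hδ : IsCellularWrt δ (associatedIdeal k c))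
    {u : Fin n →₀ ℕ} (hu : ¬ IsNil (u : c.Quotient))
    (hp : IsPartlyCancellable (u : c.Quotient)) :
    translationLattice c δ u = translationLattice c δ 0 := by
  ext w
  constructor
  · rintro ⟨a, b, ha, hb, h, rfl⟩
    refine ⟨a, b, ha, hb, ?_, rfl⟩
    rw [zero_add, zero_add, ← AddCon.eq]
    have ha' := hδ.isCancellable_iff.2 ha
    refine hp _ _ ha' (hδ.isCancellable_iff.2 hb) ?_ fun hn => hu (hn.of_add_cancellable ha')
    rwa [← AddCon.coe_add, ← AddCon.coe_add, AddCon.eq]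
  · rintro ⟨a, b, ha, hb, h, rfl⟩
    rw [zero_add, zero_add] at h
    exact ⟨a, b, ha, hb, c.add (c.refl u) h, rfl⟩

theorem IsCellularWrt.existsUnique_isAssociatedMesoprime
    (hδ : IsCellularWrt δ (associatedIdeal k c))
    (hp : ∀ q : c.Quotient, IsPartlyCancellable q) :
    ∃! P : Ideal (MvPolynomial (Fin n) k), IsAssociatedMesoprime δ (associatedIdeal k c) P := by
  refine ⟨_, hδ.isAssociatedMesoprime_iff.2 ⟨0, fun _ _ => rfl, not_isNil_coe_zero, rfl⟩, ?_⟩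
  intro P hP
  obtain ⟨u, -, hnil, rfl⟩ := hδ.isAssociatedMesoprime_iff.1 hP
  rw [hδ.translationLattice_eq hnil (hp _)]

end Ideals

end BinomialCongruence

theorem proposition5p5 (k : Type*) [Field k] (n : ℕ) (c : AddCon (Fin n →₀ ℕ)) :
    BinomialCongruence.IsMesoprimaryCongruence k c ↔
      BinomialCongruence.IsPrimaryCongruence k c ∧
        ∀ a : c.Quotient, BinomialCongruence.IsPartlyCancellable a := by
  constructor
  · rintro ⟨-, δ, hδ, hP⟩
    exact ⟨⟨δ, hδ⟩, hδ.isPartlyCancellable_of_subsingleton fun P Q hP' hQ => hP.unique hP' hQ⟩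
  · rintro ⟨⟨δ, hδ⟩, hp⟩
    exact ⟨(BinomialCongruence.isUnitalIdeal_associatedIdeal c).isBinomialIdeal, δ, hδ,
      hδ.existsUnique_isAssociatedMesoprime hp⟩
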